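/- Let $I=[0,1]$ and let $\exp X$ be the set of nonempty closed subsets of a Tychonoff space $X$; its lower topology has the subbase of all sets $\{F : F\cap U\neq\emptyset\}$, $U$ open in $X$. $\beta X\supseteq X$ denotes the Stone–Čech compactification. **Inclusion hyperspaces.** $\check GX$ is the set of all nonempty $\mathcal F\subseteq\exp X$ that are compact in the lower topology and such that $A\in\mathcal F$, $A\subseteq B\in\exp X$ imply $B\in\mathcal F$. It carries the topology making the injective map $e_G:\mathcal F\mapsto\{G\in\exp\beta X : G\cap X\in\mathcal F\}$ an embedding into $\exp(\exp\beta X)$ with the Vietoris topologies. $\hat GX\subseteq\check GX$ is the subspace of those $\mathcal F$ such that every $F\in\mathcal F$ contains a compact $K\in\mathcal F$. The multiplication $\check\mu_GX:\check G(\check GX)\to\check GX$ is $$\check\mu_GX(\mathbf F)=\Big\{F\in\exp X : F\in\bigcap H\text{ for some }H\in\mathbf F\Big\}.$$ **Capacities.** $\check MX$ is the set of all $\tau$-smooth capacities on $X$, that is, of monotone functions $c:\exp X\cup\{\emptyset\}\to I$ with $c(\emptyset)=0$, $c(X)=1$, such that $\inf_\alpha c(F_\alpha)\le c(G)$ for every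 decreasing net $(F_\alpha)$ of closed sets and every closed $G\supseteq\bigcap_\alpha F_\alpha$. It carries the topology making the injective map $e_M$, $e_M(c)(F)=c(F\cap X)$, an embedding into the space $M\beta X$ of (upper semicontinuous) capacities on $\beta X$ whose topology has the subbase of all sets $\{c : c(F)<a\}$ ($F$ closed, $a\in I$) and $\{c : c(F)>a\text{ for some closed }F\subseteq U\}$ ($U$ open, $a\in I$). $\hat MX\subseteq\check MX$ is the subspace of Radon capacities: those with $c(A)=\sup\{c(K): K\subseteq A\text{ compact}\}$ for all closed $A$. The multiplication $\check\mu_MX:\check M(\check MX)\to\check MX$ is $$\check\mu_MX(C)(F)=\sup\{\alpha\wedge C(\{c\in\check MX : c(F)\ge\alpha\}) : \alpha\in I\}.$$ Regard $\hat M^2X=\hat M(\hat MX)$ as a subset of $\check M^2X=\check M(\check MX)$ and $\hat G^2X=\hat G(\hat GX)$ as a subset of $\check G^2X=\check G(\check GX)$ by the maps induced by the inclusions $j:\hat MX\to\check MX$ and $j:\hat GX\to\check GX$, i.e. $C\mapsto(\mathcal A\mapsto C(j^{-1}(\mathcal A)))$ and $\mathbf F\mapsto\{H\text{ closed in }\check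 GX : H\supseteq j(A)\text{ for some }A\in\mathbf F\}$. **Statement.** Let $X$ be a Tychonoff space. If $\check\mu_MX(\hat M^2X)\subseteq\hat MX$, then $\check\mu_GX(\hat G^2X)\subseteq\hat GX$. -/

import Mathlib

open TopologicalSpace Set Topology
open scoped unitInterval

universe u

namespace InclCap

section InclusionHyperspaces

/-- `exp X`: the set of all nonempty closed subsets of `X`. -/
abbrev Exp (X : Type u) [TopologicalSpace X] : Type u :=
  {F : Closeds X // (F : Set X).Nonempty}

/-- The lower topology on `exp X`, with subbase the sets `{F | F ∩ U ≠ ∅}`, `U` open. -/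
@[reducible] def lowerTopology (X : Type u) [TopologicalSpace X] : TopologicalSpace (Exp X) :=
  generateFrom {S | ∃ U : Set X, IsOpen U ∧ S = {F : Exp X | ((F.1 : Set X) ∩ U).Nonempty}}

/-- For a compact Hausdorff space `K`: the space `GK` of inclusion hyperspaces, that is, of the
nonempty Vietoris closed families `𝒢` of nonempty closed subsets of `K` that contain with `A` every
larger closed set. It carries the subspace topology of `exp (exp K)` with the Vietoris topologies
(nonempty closed and nonempty compact sets are the same here; Mathlib's topology on
`NonemptyCompacts` is the Vietoris topology). -/
abbrev GComp (K : Type u) [TopologicalSpace K] [CompactSpace K] [T2Space K] : Type u :=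
  {𝒢 : NonemptyCompacts (NonemptyCompacts K) // ∀ A ∈ 𝒢, ∀ B : NonemptyCompacts K, A ≤ B → B ∈ 𝒢}

/-- The set `ǦX` of compact inclusion hyperspaces in `X`: nonempty upward closed families of
nonempty closed subsets of `X` that are compact in the lower topology on `exp X`. -/
@[ext] structure CheckG (X : Type u) [TopologicalSpace X] where
  carrier : Set (Exp X)
  nonempty : carrier.Nonempty
  upward : ∀ A ∈ carrier, ∀ B : Exp X, A.1 ≤ B.1 → B ∈ carrier
  compact : @IsCompact (Exp X) (lowerTopology X) carrier

variable {X : Type u} [TopologicalSpace X] {Y : Type u} [TopologicalSpace Y]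

theorem isOpen_hit {U : Set X} (hU : IsOpen U) :
    @IsOpen (Exp X) (lowerTopology X) {F : Exp X | ((F.1 : Set X) ∩ U).Nonempty} :=
  isOpen_generateFrom_of_mem ⟨U, hU, rfl⟩

/-- The canonical continuous map `X → βX`. -/
def unit (X : Type u) [TopologicalSpace X] : C(X, StoneCech X) :=
  ⟨stoneCechUnit, continuous_stoneCechUnit⟩

/-- A nonempty compact subset of `βX` as a closed subset. -/
def cl {K : Type u} [TopologicalSpace K] [T2Space K] (G : NonemptyCompacts K) : Closeds K :=
  ⟨G, G.isCompact.isClosed⟩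

/-- The trace `G ∩ X` on `X` of a closed subset `G` of `βX`. -/
def trace (G : Closeds (StoneCech X)) : Closeds X := G.preimage (unit X).continuous

/-- The family `{G ∈ exp βX | G ∩ X ∈ 𝓕}`. -/
def eGSet (𝓕 : CheckG X) : Set (NonemptyCompacts (StoneCech X)) :=
  {G | ∃ h : (trace (cl G) : Set X).Nonempty, (⟨trace (cl G), h⟩ : Exp X) ∈ 𝓕.carrier}

theorem eGSet_isClosed (𝓕 : CheckG X) : IsClosed (eGSet 𝓕) := by
  rw [← isOpen_compl_iff, isOpen_iff_forall_mem_open]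
  intro G hG
  have h1 : ∀ F : Exp X, F ∈ 𝓕.carrier → ∃ x ∈ (F.1 : Set X), unit X x ∉ G := by
    intro F hF
    by_contra hcon
    push Not at hcon
    have hle : (F.1 : Set X) ⊆ trace (cl G) := fun x hx => hcon x hx
    exact hG ⟨F.2.mono hle, 𝓕.upward F hF ⟨trace (cl G), F.2.mono hle⟩ hle⟩
  have h2 : ∀ F : 𝓕.carrier, ∃ V : Set (StoneCech X), IsOpen V ∧
      (((F : Exp X).1 : Set X) ∩ unit X ⁻¹' V).Nonempty ∧ Disjoint (closure V) (G : Set _) := by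
    rintro ⟨F, hF⟩
    obtain ⟨x, hx, hxG⟩ := h1 F hF
    have hop : IsOpen (G : Set (StoneCech X))ᶜ := G.isCompact.isClosed.isOpen_compl
    obtain ⟨V, hV, hVc⟩ := (hop.mem_nhds hxG : _) |> fun h =>
      (closed_nhds_basis (unit X x)).mem_iff.1 h
    refine ⟨interior V, isOpen_interior, ⟨x, hx, mem_interior_iff_mem_nhds.2 hV.1⟩, ?_⟩
    have : closure (interior V) ⊆ V := hV.2.closure_subset_iff.2 interior_subset
    exact disjoint_left.2 fun y hy hyG => hVc (this hy) hyG
  choose V hVo hVF hVG using h2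
  let _ := lowerTopology X
  obtain ⟨t, ht⟩ := 𝓕.compact.elim_finite_subcover
    (fun i => {F : Exp X | ((F.1 : Set X) ∩ unit X ⁻¹' V i).Nonempty})
    (fun i => isOpen_hit ((hVo i).preimage (unit X).continuous))
    (fun F hF => mem_iUnion.2 ⟨⟨F, hF⟩, hVF ⟨F, hF⟩⟩)
  let U : Set (StoneCech X) := ⋂ i ∈ t, (closure (V i))ᶜ
  have hU : IsOpen U := t.finite_toSet.isOpen_biInter fun i _ => isClosed_closure.isOpen_compl
  refine ⟨{H | (H : Set (StoneCech X)) ⊆ U}, ?_, NonemptyCompacts.isOpen_subsets_of_isOpen hU, ?_⟩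
  · rintro H hHU ⟨hne, hH⟩
    obtain ⟨i, hi⟩ := mem_iUnion.1 (ht hH)
    obtain ⟨hit, x, hxH, hxV⟩ := mem_iUnion.1 hi
    exact mem_iInter₂.1 (hHU hxH) i hit (subset_closure hxV)
  · intro y hy
    exact mem_iInter₂.2 fun i _ hyV => disjoint_left.1 (hVG i) hyV hy

/-- The map `e_G X : ǦX → G(βX)`, `𝓕 ↦ {G ∈ exp βX | G ∩ X ∈ 𝓕}`. -/
def eG (𝓕 : CheckG X) : GComp (StoneCech X) :=
  ⟨⟨⟨eGSet 𝓕, (eGSet_isClosed 𝓕).isCompact⟩, by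
    obtain ⟨F, hF⟩ := 𝓕.nonempty
    obtain ⟨x, hx⟩ := F.2
    refine ⟨⟨⟨univ, isCompact_univ⟩, ⟨unit X x, mem_univ _⟩⟩, ⟨x, mem_univ _⟩, ?_⟩
    exact 𝓕.upward F hF _ fun y _ => mem_univ _⟩, by
    rintro A ⟨hne, hA⟩ B hAB
    have hle : (trace (cl A) : Set X) ⊆ trace (cl B) := fun x hx => hAB hx
    exact ⟨hne.mono hle, 𝓕.upward _ hA ⟨trace (cl B), hne.mono hle⟩ hle⟩⟩

/-- `ǦX` carries the topology induced by `e_G X` from `G(βX)`. -/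
instance : TopologicalSpace (CheckG X) := induced eG inferInstance

theorem continuous_eG : Continuous (eG (X := X)) := continuous_induced_dom

/-- The set `ĜX`: those `𝓕 ∈ ǦX` each of whose elements contains a compact element of `𝓕`. As a
space it is regarded as a subspace of `ǦX`. -/
def hatG (X : Type u) [TopologicalSpace X] : Set (CheckG X) :=
  {𝓕 | ∀ F ∈ 𝓕.carrier, ∃ K ∈ 𝓕.carrier, K.1 ≤ F.1 ∧ IsCompact (K.1 : Set X)}

theorem isOpen_lower_upward {S : Set (Exp X)} (hS : @IsOpen _ (lowerTopology X) S) {A B : Exp X}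
    (hAB : A.1 ≤ B.1) (hA : A ∈ S) : B ∈ S := by
  induction hS with
  | basic s hs =>
    obtain ⟨U, -, rfl⟩ := hs
    exact hA.mono (inter_subset_inter_left U hAB)
  | univ => trivial
  | inter s t _ _ h1 h2 => exact ⟨h1 hA.1, h2 hA.2⟩
  | sUnion s _ ih =>
    obtain ⟨t, hts, hAt⟩ := hA
    exact ⟨t, hts, ih t hts hAt⟩

/-- The map `Ǧf : ǦX → ǦY`, `𝓕 ↦ {B closed in Y | B ⊇ f(A) for some A ∈ 𝓕}`. -/
def CheckG.map (f : C(X, Y)) (𝓕 : CheckG X) : CheckG Y where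
  carrier := {B | ∃ A ∈ 𝓕.carrier, f '' (A.1 : Set X) ⊆ B.1}
  nonempty := by
    obtain ⟨A, hA⟩ := 𝓕.nonempty
    obtain ⟨x, hx⟩ := A.2
    exact ⟨⟨⟨univ, isClosed_univ⟩, ⟨f x, mem_univ _⟩⟩, A, hA, fun y _ => mem_univ _⟩
  upward := by
    rintro B ⟨A, hA, hAB⟩ C hBC
    exact ⟨A, hA, hAB.trans hBC⟩
  compact := by
    let g : Exp X → Exp Y := fun A =>
      ⟨⟨closure (f '' (A.1 : Set X)), isClosed_closure⟩, (A.2.image f).closure⟩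
    have hg : @Continuous _ _ (lowerTopology X) (lowerTopology Y) g := by
      refine (@continuous_generateFrom_iff _ _ g (lowerTopology X) _).2 ?_
      rintro _ ⟨U, hU, rfl⟩
      convert isOpen_hit (X := X) (hU.preimage f.continuous) using 1
      ext A
      change (closure (f '' (A.1 : Set X)) ∩ U).Nonempty ↔ _
      rw [closure_inter_open_nonempty_iff (show IsOpen U from hU)]
      constructor
      · rintro ⟨_, ⟨x, hx, rfl⟩, hxU⟩
        exact ⟨x, hx, hxU⟩
      · rintro ⟨x, hx, hxU⟩
        exact ⟨f x, ⟨x, hx, rfl⟩, hxU⟩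
    have hK := @IsCompact.image _ _ (lowerTopology X) (lowerTopology Y) _ _ 𝓕.compact hg
    let _ := lowerTopology Y
    refine isCompact_of_finite_subcover fun {ι} U hU hcov => ?_
    obtain ⟨t, ht⟩ := hK.elim_finite_subcover U hU (by
      rintro _ ⟨A, hA, rfl⟩
      exact hcov ⟨A, hA, subset_closure⟩)
    refine ⟨t, ?_⟩
    rintro B ⟨A, hA, hAB⟩
    obtain ⟨i, hi⟩ := mem_iUnion.1 (ht ⟨A, hA, rfl⟩)
    obtain ⟨hit, hi⟩ := mem_iUnion.1 hi
    exact mem_iUnion₂.2 ⟨i, hit, isOpen_lower_upward (hU i)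
      (show (g A).1 ≤ B.1 from closure_minimal hAB B.1.isClosed) hi⟩

theorem trace_closure [T35Space X] (F : Closeds X) :
    trace (⟨closure (unit X '' (F : Set X)), isClosed_closure⟩ : Closeds (StoneCech X)) = F := by
  apply Closeds.ext
  change unit X ⁻¹' closure (unit X '' (F : Set X)) = F
  have := (isEmbedding_stoneCechUnit (X := X)).isInducing.closure_eq_preimage_closure_image
    (F : Set X)
  rw [F.isClosed.closure_eq] at this
  exact this.symm

theorem isClosed_mem [T35Space X] (F : Exp X) : IsClosed {𝓕 : CheckG X | F ∈ 𝓕.carrier} := by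
  let C : NonemptyCompacts (StoneCech X) :=
    ⟨⟨closure (unit X '' (F.1 : Set X)), isClosed_closure.isCompact⟩, (F.2.image _).closure⟩
  have hC : trace (cl C) = F.1 := trace_closure F.1
  have h1 : IsClosed {G : NonemptyCompacts (StoneCech X) | (G : Set (StoneCech X)) ⊆ C} :=
    NonemptyCompacts.isClosed_subsets_of_isClosed C.isCompact.isClosed
  have h2 := NonemptyCompacts.isClosed_inter_nonempty_of_isClosed h1
  have h3 := (h2.preimage continuous_subtype_val).preimage
    continuous_eG
  convert h3 using 1
  ext 𝓕
  constructor
  · intro h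
    refine ⟨C, ⟨?_, ?_⟩, Subset.refl (C : Set (StoneCech X))⟩
    · rw [hC]; exact F.2
    · exact 𝓕.upward F h _ hC.ge
  · rintro ⟨G, ⟨hne, hG⟩, hGC⟩
    refine 𝓕.upward _ hG F ?_
    change trace (cl G) ≤ F.1
    rw [← hC]
    exact fun x hx => hGC hx

/-- A compact inclusion hyperspace contains the intersections of its filtered subfamilies. -/
theorem CheckG.mem_of_filtered (𝓕 : CheckG X) {ι : Type*} [Nonempty ι] (F : ι → Closeds X)
    (hdir : Directed (· ≥ ·) F) (hF : ∀ i, ∃ h : (F i : Set X).Nonempty, ⟨F i, h⟩ ∈ 𝓕.carrier)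
    (G : Closeds X) (hG : (⋂ i, (F i : Set X)) ⊆ G) :
    ∃ h : (G : Set X).Nonempty, (⟨G, h⟩ : Exp X) ∈ 𝓕.carrier := by
  by_contra hcon
  have hcov : ∀ A ∈ 𝓕.carrier, ∃ i, ((A.1 : Set X) ∩ (F i : Set X)ᶜ).Nonempty := by
    intro A hA
    by_contra hno
    push Not at hno
    have hle : (A.1 : Set X) ⊆ G := fun x hx => hG (mem_iInter.2 fun i => by
      by_contra hxi
      exact (hno i ▸ (⟨hx, hxi⟩ : x ∈ (A.1 : Set X) ∩ (F i : Set X)ᶜ) : x ∈ (∅ : Set X)))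
    exact hcon ⟨A.2.mono hle, 𝓕.upward A hA ⟨G, A.2.mono hle⟩ hle⟩
  let _ := lowerTopology X
  obtain ⟨t, ht⟩ := 𝓕.compact.elim_finite_subcover
    (fun i => {A : Exp X | ((A.1 : Set X) ∩ (F i : Set X)ᶜ).Nonempty})
    (fun i => isOpen_hit (F i).isClosed.isOpen_compl)
    (fun A hA => mem_iUnion.2 (hcov A hA))
  obtain ⟨k, hk⟩ := hdir.finset_le t
  obtain ⟨hne, hmem⟩ := hF k
  obtain ⟨i, hit, x, hxk, hxi⟩ := mem_iUnion₂.1 (ht hmem)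
  exact hxi (hk i hit hxk)

/-- The multiplication `μ̌_G X : Ǧ(ǦX) → ǦX`,
`Φ ↦ {F ∈ exp X | F ∈ ⋂ H for some H ∈ Φ}`. -/
def CheckG.mul [T35Space X] (Φ : CheckG (CheckG X)) : CheckG X where
  carrier := {F | ∃ H ∈ Φ.carrier, ∀ 𝓑 ∈ H.1, F ∈ 𝓑.carrier}
  nonempty := by
    obtain ⟨H, hH⟩ := Φ.nonempty
    obtain ⟨𝓑, -⟩ := H.2
    obtain ⟨A, hA⟩ := 𝓑.nonempty
    refine ⟨⟨⟨univ, isClosed_univ⟩, A.2.mono (subset_univ _)⟩, H, hH, fun 𝓒 _ => ?_⟩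
    obtain ⟨B, hB⟩ := 𝓒.nonempty
    exact 𝓒.upward B hB _ fun y _ => mem_univ _
  upward := by
    rintro A ⟨H, hH, hA⟩ B hAB
    exact ⟨H, hH, fun 𝓑 h𝓑 => 𝓑.upward A (hA 𝓑 h𝓑) B hAB⟩
  compact := by
    have hup : ∀ A : Exp X, (∃ H ∈ Φ.carrier, ∀ 𝓑 ∈ H.1, A ∈ 𝓑.carrier) → ∀ B : Exp X,
        A.1 ≤ B.1 → ∃ H ∈ Φ.carrier, ∀ 𝓑 ∈ H.1, B ∈ 𝓑.carrier := by
      rintro A ⟨H, hH, hA⟩ B hAB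
      exact ⟨H, hH, fun 𝓑 h𝓑 => 𝓑.upward A (hA 𝓑 h𝓑) B hAB⟩
    refine @isCompact_generateFrom (Exp X) (lowerTopology X) _ rfl _ ?_
    intro P hP hcov
    by_contra hcon
    push Not at hcon
    -- `W Q` is the complement of the union of the open sets that define the finite family `Q`
    let I' := {Q : Set (Set (Exp X)) // Q ⊆ P ∧ Q.Finite}
    have : Nonempty I' := ⟨⟨∅, empty_subset _, finite_empty⟩⟩
    let V : Set (Exp X) → Set X := fun S => ⋃₀ {U | IsOpen U ∧
      S = {F : Exp X | ((F.1 : Set X) ∩ U).Nonempty}}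
    have hV : ∀ S, IsOpen (V S) := fun S => isOpen_sUnion fun U hU => hU.1
    have hVS : ∀ S ∈ P, ∀ F : Exp X, F ∈ S ↔ ((F.1 : Set X) ∩ V S).Nonempty := by
      intro S hS F
      obtain ⟨U, hU, hSU⟩ := hP hS
      constructor
      · intro hF
        have hF' := hF
        rw [hSU] at hF'
        obtain ⟨x, hx, hxU⟩ := hF'
        exact ⟨x, hx, U, ⟨hU, hSU⟩, hxU⟩
      · rintro ⟨x, hx, U', ⟨_, hSU'⟩, hxU'⟩
        rw [hSU']
        exact ⟨x, hx, hxU'⟩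
    let W : I' → Closeds X := fun Q => ⟨(⋃ S ∈ Q.1, V S)ᶜ,
      (isOpen_biUnion fun S _ => hV S).isClosed_compl⟩
    have hdirW : Directed (· ≥ ·) W := by
      intro Q R
      refine ⟨⟨Q.1 ∪ R.1, union_subset Q.2.1 R.2.1, Q.2.2.union R.2.2⟩, ?_, ?_⟩
      · exact compl_subset_compl.2 (biUnion_subset_biUnion_left subset_union_left)
      · exact compl_subset_compl.2 (biUnion_subset_biUnion_left subset_union_right)
    have hW : ∀ Q : I', ∃ h : (W Q : Set X).Nonempty,
        ∃ H ∈ Φ.carrier, ∀ 𝓑 ∈ H.1, (⟨W Q, h⟩ : Exp X) ∈ 𝓑.carrier := by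
      intro Q
      obtain ⟨A, hA, hAQ⟩ := not_subset.1 (hcon Q.1 Q.2.1 Q.2.2)
      have hle : (A.1 : Set X) ⊆ W Q := by
        intro x hx hxW
        obtain ⟨S, hS, hxS⟩ := mem_iUnion₂.1 hxW
        exact hAQ ⟨S, hS, (hVS S (Q.2.1 hS) A).2 ⟨x, hx, hxS⟩⟩
      exact ⟨A.2.mono hle, hup A hA ⟨W Q, A.2.mono hle⟩ hle⟩
    let T : I' → Closeds (CheckG X) := fun Q =>
      ⟨{𝓑 | (⟨W Q, (hW Q).1⟩ : Exp X) ∈ 𝓑.carrier}, isClosed_mem _⟩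
    have hT : Directed (· ≥ ·) T := by
      intro Q R
      obtain ⟨S, h1, h2⟩ := hdirW Q R
      exact ⟨S, fun 𝓑 h𝓑 => 𝓑.upward _ h𝓑 _ h1, fun 𝓑 h𝓑 => 𝓑.upward _ h𝓑 _ h2⟩
    have hTF : ∀ Q, ∃ h : (T Q : Set (CheckG X)).Nonempty, ⟨T Q, h⟩ ∈ Φ.carrier := by
      intro Q
      obtain ⟨h, H, hH, hB⟩ := hW Q
      have hle : (H.1 : Set (CheckG X)) ⊆ T Q := fun 𝓑 h𝓑 => hB 𝓑 h𝓑
      exact ⟨H.2.mono hle, Φ.upward H hH ⟨T Q, H.2.mono hle⟩ hle⟩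
    obtain ⟨hne, hmem⟩ := Φ.mem_of_filtered T hT hTF
      ⟨⋂ Q, (T Q : Set (CheckG X)), isClosed_iInter fun Q => (T Q).isClosed⟩ subset_rfl
    have hE : ∀ 𝓑 ∈ ⋂ Q, (T Q : Set (CheckG X)), ∃ h : ((⨅ Q, W Q : Closeds X) : Set X).Nonempty,
        (⟨⨅ Q, W Q, h⟩ : Exp X) ∈ 𝓑.carrier := by
      intro 𝓑 h𝓑
      refine 𝓑.mem_of_filtered W hdirW (fun Q => ⟨_, mem_iInter.1 h𝓑 Q⟩) _ ?_
      rw [Closeds.coe_iInf]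
    obtain ⟨𝓑₀, h𝓑₀⟩ := hne
    obtain ⟨hEne, -⟩ := hE 𝓑₀ h𝓑₀
    obtain ⟨S, hSP, hS⟩ := hcov (show (⟨⨅ Q, W Q, hEne⟩ : Exp X) ∈
      {F : Exp X | ∃ H ∈ Φ.carrier, ∀ 𝓑 ∈ H.1, F ∈ 𝓑.carrier} from
      ⟨_, hmem, fun 𝓑 h𝓑 => (hE 𝓑 h𝓑).2⟩)
    obtain ⟨x, hx, hxS⟩ := (hVS S hSP _).1 hS
    change x ∈ ((⨅ Q, W Q : Closeds X) : Set X) at hx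
    rw [Closeds.coe_iInf] at hx
    exact mem_iInter.1 hx ⟨{S}, singleton_subset_iff.2 hSP, finite_singleton S⟩
      (mem_iUnion₂.2 ⟨S, rfl, hxS⟩)

/-- The canonical map `Ĝ(ĜX) → Ǧ(ǦX)`, by which `Ĝ²X` is regarded as a subspace of `Ǧ²X`: it is
induced by the inclusion of `ĜX` in `ǦX`. -/
def hatGSqIncl (Φ : hatG (hatG X)) : CheckG (CheckG X) :=
  CheckG.map ⟨Subtype.val, continuous_subtype_val⟩ (Φ : CheckG (hatG X))

end InclusionHyperspaces

section Capacities

/-- For a compact Hausdorff space `K`: the set `MK` of capacities on `K`, i.e. of monotone, upper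
semicontinuous functions `c : exp K ∪ {∅} → I` with `c ∅ = 0` and `c K = 1`. -/
structure MComp (K : Type u) [TopologicalSpace K] [CompactSpace K] [T2Space K] where
  toFun : Closeds K → I
  map_empty : toFun ⊥ = 0
  map_univ : toFun ⊤ = 1
  mono : Monotone toFun
  usc : ∀ (F : Closeds K) (a : I), toFun F < a →
    ∃ U : Set K, IsOpen U ∧ (F : Set K) ⊆ U ∧ ∀ G : Closeds K, (G : Set K) ⊆ U → toFun G < a

/-- The topology on `MK` with the subbase of all sets `O₋(F, a) = {c | c F < a}`, `F` closed, and
`O₊(U, a) = {c | c F > a for some closed F ⊆ U}`, `U` open. -/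
instance (K : Type u) [TopologicalSpace K] [CompactSpace K] [T2Space K] :
    TopologicalSpace (MComp K) :=
  generateFrom ({S | ∃ (F : Closeds K) (a : I), S = {c : MComp K | c.toFun F < a}} ∪
    {S | ∃ (U : Set K) (a : I), IsOpen U ∧
      S = {c : MComp K | ∃ F : Closeds K, (F : Set K) ⊆ U ∧ a < c.toFun F}})

/-- The set `M̌X` of (`τ`-smooth) capacities on `X`: monotone functions `c : exp X ∪ {∅} → I` with
`c ∅ = 0`, `c X = 1` such that `inf c(F_i) ≤ c(G)` for each decreasing net `(F_i)` of closed sets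
and each closed `G ⊇ ⋂ F_i`. -/
@[ext] structure CheckM (X : Type u) [TopologicalSpace X] where
  toFun : Closeds X → I
  map_empty : toFun ⊥ = 0
  map_univ : toFun ⊤ = 1
  mono : Monotone toFun
  tau_smooth : ∀ (ι : Type u) [Preorder ι] [IsDirectedOrder ι] [Nonempty ι] (F : ι → Closeds X),
    Antitone F → ∀ G : Closeds X, (⋂ i, (F i : Set X)) ⊆ G → ⨅ i, toFun (F i) ≤ toFun G

variable {X : Type u} [TopologicalSpace X] {Y : Type u} [TopologicalSpace Y]

/-- The map `e_M X : M̌X → M(βX)`, `e_M X (c) (F) = c (F ∩ X)`. -/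
def eM (c : CheckM X) : MComp (StoneCech X) where
  toFun F := c.toFun (trace F)
  map_empty := by
    rw [← c.map_empty]
    congr 1
  map_univ := by
    rw [← c.map_univ]
    congr 1
  mono := fun F G h => c.mono fun x hx => h hx
  usc := by
    intro F a ha
    let ι := (OrderDual {N : Closeds (StoneCech X) // (N : Set (StoneCech X)) ∈ 𝓝ˢ (F : Set _)})
    have : Nonempty ι := ⟨OrderDual.toDual ⟨⊤, Filter.univ_mem⟩⟩
    have : IsDirectedOrder ι := ⟨fun N P => ⟨OrderDual.toDual
      ⟨(OrderDual.ofDual N).1 ⊓ (OrderDual.ofDual P).1,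
        Filter.inter_mem (OrderDual.ofDual N).2 (OrderDual.ofDual P).2⟩,
      (inf_le_left : (OrderDual.ofDual N).1 ⊓ (OrderDual.ofDual P).1 ≤ _),
      (inf_le_right : (OrderDual.ofDual N).1 ⊓ (OrderDual.ofDual P).1 ≤ _)⟩⟩
    have h := c.tau_smooth ι (fun N => trace (OrderDual.ofDual N).1)
      (fun N P hNP x hx =>
        (show (OrderDual.ofDual P).1 ≤ (OrderDual.ofDual N).1 from hNP) hx) (trace F) (by
        intro x hx
        by_contra hxF
        have hxF' : unit X x ∉ (F : Set (StoneCech X)) := hxF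
        obtain ⟨A, B, hA, hB, hxA, hFB, hAB⟩ :=
          SeparatedNhds.of_isCompact_isClosed isCompact_singleton F.isClosed
            (disjoint_singleton_left.2 hxF')
        have := mem_iInter.1 hx (OrderDual.toDual ⟨⟨Aᶜ, hA.isClosed_compl⟩,
          Filter.mem_of_superset (hB.mem_nhdsSet.2 hFB) (hAB.symm.subset_compl_right)⟩)
        exact this (hxA rfl))
    obtain ⟨N, hN⟩ := iInf_lt_iff.1 (h.trans_lt ha)
    obtain ⟨U, hU, hFU, hUN⟩ := mem_nhdsSet_iff_exists.1 (OrderDual.ofDual N).2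
    exact ⟨U, hU, hFU, fun G hG => (c.mono fun x hx => hUN (hG hx)).trans_lt hN⟩

/-- `M̌X` carries the topology induced by `e_M X` from `M(βX)`. -/
instance : TopologicalSpace (CheckM X) := induced eM inferInstance

theorem continuous_eM : Continuous (eM (X := X)) := continuous_induced_dom

/-- The set `M̂X` of Radon capacities: those `c ∈ M̌X` with `c A = sup {c K | K ⊆ A compact}` for
all closed `A`. As a space it is regarded as a subspace of `M̌X`. (In a Hausdorff space all compact
sets are closed.) -/
def hatM (X : Type u) [TopologicalSpace X] : Set (CheckM X) :=
  {c | ∀ A : Closeds X,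
    c.toFun A = sSup {r | ∃ K : Closeds X, IsCompact (K : Set X) ∧ K ≤ A ∧ r = c.toFun K}}

/-- The map `M̌f : M̌X → M̌Y`, `M̌f(c)(F) = c (f⁻¹ F)`. -/
def CheckM.map (f : C(X, Y)) (c : CheckM X) : CheckM Y where
  toFun F := c.toFun (F.preimage f.continuous)
  map_empty := by
    rw [← c.map_empty]
    congr 1
  map_univ := by
    rw [← c.map_univ]
    congr 1
  mono := fun F G h => c.mono fun x hx => h hx
  tau_smooth := by
    intro ι _ _ _ F hF G hG
    refine c.tau_smooth ι (fun i => (F i).preimage f.continuous)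
      (fun i j hij x hx => hF hij hx) _ fun x hx => hG (mem_iInter.2 fun i => mem_iInter.1 hx i)

theorem isClosed_ge [T35Space X] (F : Closeds X) (α : I) :
    IsClosed {c : CheckM X | α ≤ c.toFun F} := by
  rw [← isOpen_compl_iff]
  let D : Closeds (StoneCech X) := ⟨closure (unit X '' (F : Set X)), isClosed_closure⟩
  have h1 : IsOpen {d : MComp (StoneCech X) | d.toFun D < α} :=
    isOpen_generateFrom_of_mem (Or.inl ⟨D, α, rfl⟩)
  convert h1.preimage continuous_eM using 1
  ext c
  change ¬ (α ≤ c.toFun F) ↔ c.toFun (trace D) < α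
  rw [trace_closure F, not_le]

/-- The closed set `{c ∈ M̌X | c F ≥ α}`. -/
def upperSet [T35Space X] (F : Closeds X) (α : I) : Closeds (CheckM X) :=
  ⟨{c | α ≤ c.toFun F}, isClosed_ge F α⟩

/-- The multiplication `μ̌_M X : M̌(M̌X) → M̌X`,
`μ̌_M X (C) (F) = sup {α ∧ C {c ∈ M̌X | c F ≥ α} | α ∈ I}`. -/
noncomputable def CheckM.mul [T35Space X] (C : CheckM (CheckM X)) : CheckM X where
  toFun F := ⨆ α : I, α ⊓ C.toFun (upperSet F α)
  map_empty := by
    refine le_antisymm (iSup_le fun α => ?_) bot_le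
    rcases eq_or_lt_of_le (bot_le : (0 : I) ≤ α) with h | h
    · exact inf_le_left.trans h.symm.le
    · refine inf_le_right.trans (le_of_eq ?_)
      rw [← C.map_empty]
      congr 1
      apply Closeds.ext
      ext c
      change α ≤ c.toFun ⊥ ↔ False
      rw [c.map_empty]
      simpa using (show α ≠ 0 from h.ne')
  map_univ := by
    refine le_antisymm le_top (le_iSup_of_le 1 (le_inf le_rfl (le_of_eq ?_)))
    have : upperSet (⊤ : Closeds X) 1 = ⊤ := by
      apply Closeds.ext
      ext c
      change 1 ≤ c.toFun ⊤ ↔ True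
      rw [c.map_univ]
      simp
    rw [this, C.map_univ]
  mono := fun F G h => iSup_mono fun α =>
    inf_le_inf_left α (C.mono fun c hc => le_trans hc (c.mono h))
  tau_smooth := by
    intro ι _ _ _ F hF G hG
    refine le_of_forall_gt_imp_ge_of_dense fun t ht => ?_
    have h1 : C.toFun (upperSet G t) < t := by
      by_contra hcon
      rw [not_lt] at hcon
      exact absurd (le_iSup_of_le (f := fun α : I => α ⊓ C.toFun (upperSet G α)) t
        (le_inf le_rfl hcon)) ht.not_ge
    have h2 := C.tau_smooth ι (fun i => upperSet (F i) t)
      (fun i j hij c hc => le_trans hc (c.mono (hF hij))) (upperSet G t) (fun c hc =>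
        (le_iInf fun i => mem_iInter.1 hc i).trans (c.tau_smooth ι F hF G hG))
    obtain ⟨i, hi⟩ := iInf_lt_iff.1 (h2.trans_lt h1)
    refine iInf_le_of_le i (iSup_le fun s => ?_)
    rcases le_total s t with hst | hst
    · exact inf_le_left.trans hst
    · exact inf_le_right.trans ((C.mono fun c hc => le_trans hst hc).trans hi.le)

/-- The canonical map `M̂(M̂X) → M̌(M̌X)`, by which `M̂²X` is regarded as a subspace of `M̌²X`: it is
induced by the inclusion of `M̂X` in `M̌X`. -/
def hatMSqIncl (C : hatM (hatM X)) : CheckM (CheckM X) :=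
  CheckM.map ⟨Subtype.val, continuous_subtype_val⟩ (C : CheckM (hatM X))

end Capacities

end InclCap

namespace InclCap

/-! An inclusion hyperspace `𝓕` is a capacity with values in `{0, 1}`: its indicator `c(F) = 1` iff
`F ∈ 𝓕`. Compactness of `𝓕` in the lower topology makes the indicator `τ`-smooth, and "every member
contains a compact member" is exactly the Radon condition for it. Hence `ĜX` is the preimage of
`M̂X` (`toCapacity_mem_hatM`, `mem_hatG_of_toCapacity_mem_hatM`). The indicator map is continuous
(`continuous_toCapacity`), so `Φ ∈ Ĝ²X` yields an element of `M̂²X`: the indicator of `Φ` on `ĜX`,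
pushed forward along `ĜX → M̂X`. Pushing forward keeps it Radon because `M̂X` is Hausdorff
(`map_mem_hatM`). The multiplications agree under this passage (`mul_hatMSqIncl_hatGSqToHatMSq`):
the indicator of the product of `Φ` is the product of a member of `M̂²X`. By hypothesis it is Radon,
so the product of `Φ` lies in `ĜX`. -/

section Embedding

variable {X : Type u} [TopologicalSpace X] {Y : Type u} [TopologicalSpace Y]

/-! ### Inclusion hyperspaces as two-valued capacities -/

/-- Membership of a possibly empty closed set in an inclusion hyperspace. -/
def CheckG.Contains (𝓕 : CheckG X) (F : Closeds X) : Prop :=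
  ∃ h : (F : Set X).Nonempty, (⟨F, h⟩ : Exp X) ∈ 𝓕.carrier

theorem CheckG.Contains.mono {𝓕 : CheckG X} {F G : Closeds X} (hF : 𝓕.Contains F) (h : F ≤ G) :
    𝓕.Contains G := by
  obtain ⟨hne, hF⟩ := hF
  exact ⟨hne.mono h, 𝓕.upward _ hF ⟨G, hne.mono h⟩ h⟩

theorem CheckG.not_contains_bot (𝓕 : CheckG X) : ¬ 𝓕.Contains ⊥ := by
  rintro ⟨⟨x, hx⟩, -⟩
  exact hx

theorem CheckG.contains_top (𝓕 : CheckG X) : 𝓕.Contains ⊤ := by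
  obtain ⟨F, hF⟩ := 𝓕.nonempty
  exact CheckG.Contains.mono ⟨F.2, hF⟩ le_top

open Classical in
/-- The capacity that is `1` on the members of an inclusion hyperspace and `0` elsewhere. -/
noncomputable def CheckG.toCapacity (𝓕 : CheckG X) : CheckM X where
  toFun F := if 𝓕.Contains F then 1 else 0
  map_empty := if_neg 𝓕.not_contains_bot
  map_univ := if_pos 𝓕.contains_top
  mono F G h := by
    by_cases hF : 𝓕.Contains F
    · simp only [if_pos hF, if_pos (hF.mono h), le_refl]
    · simp only [if_neg hF]
      exact bot_le
  tau_smooth ι _ _ _ F hF G hG := by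
    -- If every `F i` is a member, compactness puts `G` in `𝓕`; otherwise some value is already `0`,
    -- and so is the infimum.
    by_cases h : ∀ i, 𝓕.Contains (F i)
    · have hGc : 𝓕.Contains G := 𝓕.mem_of_filtered F hF.directed_ge h G hG
      rw [if_pos hGc]
      exact le_top
    · push Not at h
      obtain ⟨i, hi⟩ := h
      refine iInf_le_of_le i ?_
      rw [if_neg hi]
      exact bot_le

theorem CheckG.toCapacity_of_contains {𝓕 : CheckG X} {F : Closeds X} (h : 𝓕.Contains F) :
    𝓕.toCapacity.toFun F = 1 := if_pos h

theorem CheckG.toCapacity_of_not_contains {𝓕 : CheckG X} {F : Closeds X} (h : ¬ 𝓕.Contains F) :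
    𝓕.toCapacity.toFun F = 0 := if_neg h

/-- With only the values `0` and `1`, every nondegenerate threshold tests membership. The strict
form excludes `a = 1`, the weak form below excludes `a = 0`. -/
theorem CheckG.lt_toCapacity_iff {𝓕 : CheckG X} {F : Closeds X} {a : I} (ha : a < 1) :
    a < 𝓕.toCapacity.toFun F ↔ 𝓕.Contains F := by
  by_cases h : 𝓕.Contains F
  · simp [toCapacity_of_contains h, h, ha]
  · rw [toCapacity_of_not_contains h]
    exact iff_of_false (not_lt.2 bot_le) h

theorem CheckG.le_toCapacity_iff {𝓕 : CheckG X} {F : Closeds X} {a : I} (ha : 0 < a) :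
    a ≤ 𝓕.toCapacity.toFun F ↔ 𝓕.Contains F := by
  by_cases h : 𝓕.Contains F
  · rw [toCapacity_of_contains h]
    exact iff_of_true le_top h
  · rw [toCapacity_of_not_contains h]
    exact iff_of_false (not_le.2 ha) h

theorem CheckG.toCapacity_mem_hatM {𝓕 : CheckG X} (h𝓕 : 𝓕 ∈ hatG X) : 𝓕.toCapacity ∈ hatM X := by
  intro A
  refine le_antisymm ?_ (sSup_le ?_)
  · by_cases h : 𝓕.Contains A
    · obtain ⟨K, hK, hKA, hKc⟩ := h𝓕 _ h.2
      refine le_sSup ⟨K.1, hKc, hKA, ?_⟩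
      rw [toCapacity_of_contains h, toCapacity_of_contains ⟨K.2, hK⟩]
    · rw [toCapacity_of_not_contains h]
      exact bot_le
  · rintro _ ⟨K, -, hKA, rfl⟩
    exact 𝓕.toCapacity.mono hKA

/-! ### Continuity of the indicator map -/

theorem mem_eG_iff {𝓕 : CheckG X} {G : NonemptyCompacts (StoneCech X)} :
    G ∈ (eG 𝓕).1 ↔ 𝓕.Contains (trace (cl G)) := Iff.rfl

/-- Preimage under `eG` of the Vietoris open set of families meeting `{G | G ⊆ U}`. It handles the
subbasic sets `O₊(U, a)`. -/
theorem isOpen_eG_hit {U : Set (StoneCech X)} (hU : IsOpen U) :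
    IsOpen {𝓕 : CheckG X | ∃ F : Closeds (StoneCech X), (F : Set _) ⊆ U ∧
      𝓕.Contains (trace F)} := by
  have h1 := NonemptyCompacts.isOpen_inter_nonempty_of_isOpen
    (NonemptyCompacts.isOpen_subsets_of_isOpen hU)
  convert (h1.preimage continuous_subtype_val).preimage (continuous_eG (X := X)) using 1
  ext 𝓕
  constructor
  · rintro ⟨F, hFU, hF⟩
    obtain ⟨x, hx⟩ := hF.1
    exact ⟨⟨⟨F, F.isClosed.isCompact⟩, ⟨unit X x, hx⟩⟩, hF, hFU⟩
  · rintro ⟨G, hG, hGU⟩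
    exact ⟨cl G, hGU, hG⟩

/-- A family meets the Vietoris closed set `{G | G ⊆ F}` iff it contains `F`, by upward closure. The
complement handles `O₋(F, a)`. -/
theorem isClosed_contains_trace (F : Closeds (StoneCech X)) :
    IsClosed {𝓕 : CheckG X | 𝓕.Contains (trace F)} := by
  have h1 := NonemptyCompacts.isClosed_inter_nonempty_of_isClosed
    (NonemptyCompacts.isClosed_subsets_of_isClosed F.isClosed)
  convert (h1.preimage continuous_subtype_val).preimage (continuous_eG (X := X)) using 1
  ext 𝓕
  constructor
  · intro hF
    obtain ⟨x, hx⟩ := hF.1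
    exact ⟨⟨⟨F, F.isClosed.isCompact⟩, ⟨unit X x, hx⟩⟩, hF, Subset.refl (F : Set (StoneCech X))⟩
  · rintro ⟨G, hG, hGF⟩
    exact (mem_eG_iff.1 hG).mono fun x hx => hGF hx

theorem continuous_toCapacity : Continuous (CheckG.toCapacity (X := X)) := by
  refine continuous_induced_rng.2 (continuous_generateFrom_iff.2 ?_)
  rintro _ (⟨F, a, rfl⟩ | ⟨U, a, hU, rfl⟩)
  -- The degenerate thresholds, `a = 0` here and `a = 1` for `O₊`, give empty sets.
  · rcases eq_or_lt_of_le (bot_le : (0 : I) ≤ a) with rfl | ha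
    · convert isOpen_empty
      exact eq_empty_of_forall_notMem fun 𝓕 h => not_lt_bot (α := I) h
    · convert (isClosed_contains_trace F).isOpen_compl using 1
      ext 𝓕
      exact not_le.symm.trans (not_congr (CheckG.le_toCapacity_iff ha))
  · rcases eq_or_lt_of_le (le_top : a ≤ (1 : I)) with rfl | ha
    · convert isOpen_empty
      exact eq_empty_of_forall_notMem fun 𝓕 ⟨F, _, h⟩ => not_lt.2 le_top h
    · convert isOpen_eG_hit hU using 1
      ext 𝓕
      exact exists_congr fun F => and_congr_right fun _ => CheckG.lt_toCapacity_iff ha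

/-! ### Hausdorffness of capacity spaces and Radon images -/

/-- Upper semicontinuity keeps `c` below an intermediate `a` on a neighbourhood of `F`. Normality
gives an open `V ⊇ F` whose closure lies in it; by monotonicity `O₋(closure V, a)` and `O₊(V, a)`
are disjoint. -/
theorem MComp.exists_disjoint_nhds {K : Type u} [TopologicalSpace K] [CompactSpace K] [T2Space K]
    {c d : MComp K} {F : Closeds K} (h : c.toFun F < d.toFun F) :
    ∃ S T : Set (MComp K), IsOpen S ∧ IsOpen T ∧ c ∈ S ∧ d ∈ T ∧ Disjoint S T := by
  obtain ⟨a, hca, had⟩ := exists_between h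
  obtain ⟨U, hU, hFU, hcU⟩ := c.usc F a hca
  obtain ⟨V, hV, hFV, hVU⟩ := normal_exists_closure_subset F.isClosed hU hFU
  refine ⟨{e | e.toFun ⟨closure V, isClosed_closure⟩ < a},
    {e | ∃ G : Closeds K, (G : Set K) ⊆ V ∧ a < e.toFun G},
    isOpen_generateFrom_of_mem (Or.inl ⟨_, a, rfl⟩),
    isOpen_generateFrom_of_mem (Or.inr ⟨V, a, hV, rfl⟩), hcU _ hVU, ⟨F, hFV, had⟩, ?_⟩
  refine disjoint_left.2 fun e he ⟨G, hGV, hG⟩ => ?_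
  exact (hG.trans_le (e.mono fun x hx => subset_closure (hGV hx))).not_gt he

theorem MComp.toFun_injective {K : Type u} [TopologicalSpace K] [CompactSpace K] [T2Space K] :
    Function.Injective (MComp.toFun (K := K)) := by
  rintro ⟨⟩ ⟨⟩ rfl
  rfl

instance (K : Type u) [TopologicalSpace K] [CompactSpace K] [T2Space K] : T2Space (MComp K) := by
  refine ⟨fun c d hcd => ?_⟩
  obtain ⟨F, hF⟩ := Function.ne_iff.1 (MComp.toFun_injective.ne hcd)
  rcases lt_or_gt_of_ne hF with h | h
  · exact MComp.exists_disjoint_nhds h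
  · obtain ⟨S, T, hS, hT, hd, hc, hST⟩ := MComp.exists_disjoint_nhds h
    exact ⟨T, S, hT, hS, hc, hd, hST.symm⟩

theorem eM_injective [T35Space X] : Function.Injective (eM (X := X)) := by
  intro c d h
  ext1
  funext F
  have := congrArg (fun e : MComp (StoneCech X) =>
    e.toFun ⟨closure (unit X '' (F : Set X)), isClosed_closure⟩) h
  simpa only [eM, trace_closure] using this

instance [T35Space X] : T2Space (CheckM X) := T2Space.of_injective_continuous eM_injective
  continuous_eM

/-- A compact `K ⊆ f⁻¹(A)` is replaced by `f(K) ⊆ A`, whose preimage contains `K`. Hausdorffness of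
`Y` makes `f(K)` closed. -/
theorem CheckM.map_mem_hatM [T2Space Y] (f : C(X, Y)) {c : CheckM X} (hc : c ∈ hatM X) :
    CheckM.map f c ∈ hatM Y := by
  intro A
  refine le_antisymm ((hc (A.preimage f.continuous)).trans_le (sSup_le ?_)) (sSup_le ?_)
  · rintro _ ⟨K, hK, hKA, rfl⟩
    have hfK := hK.image f.continuous
    exact (c.mono fun x hx => mem_image_of_mem f hx).trans
      (le_sSup ⟨⟨f '' K, hfK.isClosed⟩, hfK, image_subset_iff.2 hKA, rfl⟩)
  · rintro _ ⟨K, -, hKA, rfl⟩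
    exact (CheckM.map f c).mono hKA

/-! ### Compatibility with the multiplications -/

/-- The inclusion of `ĜX` in `M̂X`. -/
noncomputable def hatGToHatM (X : Type u) [TopologicalSpace X] : C(hatG X, hatM X) :=
  ⟨fun 𝓕 => ⟨𝓕.1.toCapacity, CheckG.toCapacity_mem_hatM 𝓕.2⟩,
    (continuous_toCapacity.comp continuous_subtype_val).subtype_mk _⟩

/-- The inclusion of `Ĝ(ĜX)` in `M̂(M̂X)`. -/
noncomputable def hatGSqToHatMSq [T35Space X] (Φ : hatG (hatG X)) : hatM (hatM X) :=
  ⟨CheckM.map (hatGToHatM X) (Φ : CheckG (hatG X)).toCapacity,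
    CheckM.map_mem_hatM _ (CheckG.toCapacity_mem_hatM Φ.2)⟩

theorem isClosed_contains [T35Space X] (F : Closeds X) :
    IsClosed {𝓕 : CheckG X | 𝓕.Contains F} := by
  simpa only [trace_closure] using
    isClosed_contains_trace ⟨closure (unit X '' (F : Set X)), isClosed_closure⟩

/-- The closed set of all `𝓕 ∈ ĜX` that contain `F`. -/
def hatContaining [T35Space X] (F : Closeds X) : Closeds (hatG X) :=
  ⟨{𝓕 | 𝓕.1.Contains F}, (isClosed_contains F).preimage continuous_subtype_val⟩

/-- Upward closure allows the witness `H` to be taken as large as possible, namely all hyperspaces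
containing `F`; its trace on `ĜX` is `hatContaining F`. -/
theorem mul_hatGSqIncl_contains_iff [T35Space X] (Φ : hatG (hatG X)) (F : Closeds X) :
    (hatGSqIncl Φ).mul.Contains F ↔ (Φ : CheckG (hatG X)).Contains (hatContaining F) := by
  constructor
  · rintro ⟨hF, H, ⟨A, hA, hAH⟩, hH⟩
    exact CheckG.Contains.mono ⟨A.2, hA⟩ fun 𝓑 h𝓑 => ⟨hF, hH 𝓑.1 (hAH ⟨𝓑, h𝓑, rfl⟩)⟩
  · rintro ⟨⟨𝓑, h𝓑⟩, hΦ⟩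
    -- The point `𝓑` supplies nonemptiness both of `F` and of the witness.
    exact ⟨h𝓑.1, ⟨⟨{𝓕 | 𝓕.Contains F}, isClosed_contains F⟩, ⟨𝓑.1, h𝓑⟩⟩,
      ⟨_, hΦ, image_subset_iff.2 fun _ h => h⟩, fun 𝓒 h𝓒 => h𝓒.2⟩

/-- The embedding of inclusion hyperspaces into capacities commutes with the multiplications. -/
theorem mul_hatMSqIncl_hatGSqToHatMSq [T35Space X] (Φ : hatG (hatG X)) :
    (hatMSqIncl (hatGSqToHatMSq Φ)).mul = (hatGSqIncl Φ).mul.toCapacity := by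
  ext1
  funext F
  -- The set pulled back to `ĜX` does not depend on `α > 0`, so the supremum of `α ∧ const` is that
  -- constant.
  have hval : ∀ α : I, 0 < α → (hatMSqIncl (hatGSqToHatMSq Φ)).toFun (upperSet F α) =
      (Φ : CheckG (hatG X)).toCapacity.toFun (hatContaining F) := by
    intro α hα
    refine congrArg (Φ : CheckG (hatG X)).toCapacity.toFun (Closeds.ext ?_)
    ext 𝓑
    exact CheckG.le_toCapacity_iff hα
  change ⨆ α : I, α ⊓ (hatMSqIncl (hatGSqToHatMSq Φ)).toFun (upperSet F α) = _
  by_cases h : (hatGSqIncl Φ).mul.Contains F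
  · rw [CheckG.toCapacity_of_contains h]
    refine le_antisymm le_top (le_iSup_of_le 1 (le_inf le_rfl ?_))
    rw [hval 1 zero_lt_one,
      CheckG.toCapacity_of_contains ((mul_hatGSqIncl_contains_iff Φ F).1 h)]
  · rw [CheckG.toCapacity_of_not_contains h]
    refine le_antisymm (iSup_le fun α => ?_) bot_le
    -- At `α = 0` the upper set is the whole space, of value `1`; the meet with `α` removes this
    -- term.
    rcases eq_or_lt_of_le (bot_le : (0 : I) ≤ α) with hα | hα
    · exact inf_le_left.trans hα.ge
    · refine inf_le_right.trans (le_of_eq ?_)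
      rw [hval α hα, CheckG.toCapacity_of_not_contains
        (mt (mul_hatGSqIncl_contains_iff Φ F).2 h)]

/-- A member has value `1`, a supremum over compact subsets, so some compact subset has positive
value and is therefore a member. -/
theorem CheckG.mem_hatG_of_toCapacity_mem_hatM {𝓕 : CheckG X} (h : 𝓕.toCapacity ∈ hatM X) :
    𝓕 ∈ hatG X := by
  intro F hF
  have hpos : (0 : I) < 𝓕.toCapacity.toFun F := by
    rw [toCapacity_of_contains ⟨F.2, hF⟩]
    exact zero_lt_one
  rw [h F.1] at hpos
  obtain ⟨_, ⟨K, hKc, hKF, rfl⟩, hK⟩ := lt_sSup_iff.1 hpos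
  obtain ⟨hne, hmem⟩ := (lt_toCapacity_iff zero_lt_one).1 hK
  exact ⟨⟨K, hne⟩, hmem, hKF, hKc⟩

end Embedding

end InclCap

theorem mainTheorem6 (X : Type u) [TopologicalSpace X] [T35Space X]
    (h : ∀ C : InclCap.hatM (InclCap.hatM X),
      (InclCap.hatMSqIncl C).mul ∈ InclCap.hatM X) :
    ∀ Φ : InclCap.hatG (InclCap.hatG X),
      (InclCap.hatGSqIncl Φ).mul ∈ InclCap.hatG X := by
  intro Φ
  refine InclCap.CheckG.mem_hatG_of_toCapacity_mem_hatM ?_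
  rw [← InclCap.mul_hatMSqIncl_hatGSqToHatMSq]
  exact h _
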